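/- Let $k\ge 1$ and $N=\mathbb{C}^k$ with coordinates $\sigma=(\sigma_1,\dots,\sigma_k)$, $\partial_h=\partial/\partial\sigma_h$, $E=\sum_{h=1}^k\sigma_h\partial_h$, and $P_\sigma(z)=z^k+\sum_{h=1}^k(-1)^h\sigma_h z^{k-h}$. For $p\in[1,k-1]$, $q\in[2,k]$ put $A_{p,q}=\partial_p\partial_q-\partial_{p+1}\partial_{q-1}$, and for $m\in[2,k]$ put $\tilde T^m=\partial_1\partial_{m-1}+\partial_mE+\partial_m$, where $\partial_m E$ is the composition $F\mapsto\partial_m(E(F))$. A holomorphic function $G:N\to\mathbb{C}$ is said to solve the system $S\,2)$ if $A_{p,q}G=0$ and $\tilde T^mG=0$ on $N$ for all these $p,q,m$. For entire $g:\mathbb{C}\to\mathbb{C}$ and holomorphic $G:N\to\mathbb C$, write $G=\tilde T(g)$, and call $G$ the trace form of $g$, if $$G(\sigma)=\sum_{j=1}^k\frac{g(z_j)}{P_\sigma'(z_j)}$$ for every $\sigma\in N$ at which the discriminant of $P_\sigma$ is non-zero, $z_1,\dots,z_k$ being the roots of $P_\sigma$. (a) If a holomorphic function $G:N\to\mathbb{C}$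 solves $S\,2)$, then there is a unique entire function $g:\mathbb{C}\to\mathbb{C}$, vanishing at $0$ to order at least $k-1$, such that $G=\tilde T(g)$. (b) For every entire function $f:\mathbb{C}\to\mathbb{C}$ there is exactly one holomorphic function $G$ on $N$ with $G=\tilde T(f)$, and the holomorphic functions on $N$ that solve $S\,2)$ are exactly these trace forms: a holomorphic $G:N\to\mathbb{C}$ solves $S\,2)$ if and only if $G=\tilde T(f)$ for some entire $f$. -/

import Mathlib

noncomputable section

namespace TraceForms

/-- The space `N = ℂ^k`. The one-based coordinate `σ_h`, `1 ≤ h ≤ k`, is the entry `σ ⟨h - 1, _⟩`. -/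
abbrev N (k : ℕ) : Type := Fin k → ℂ

/-- The monic polynomial `P_σ(z) = z^k + ∑_{h=1}^k (-1)^h σ_h z^(k-h)`. -/
def P {k : ℕ} (σ : N k) : Polynomial ℂ :=
  Polynomial.X ^ k +
    ∑ i : Fin k, Polynomial.C ((-1) ^ (i.val + 1) * σ i) * Polynomial.X ^ (k - (i.val + 1))

/-- The coordinate vector in the direction of `σ_h`, for a one-based index `h` in `[1, k]`. -/
def basisVec (k h : ℕ) : N k := fun i => if i.val + 1 = h then 1 else 0

/-- The partial derivative `∂_h = ∂/∂σ_h`, for a one-based index `h` in `[1, k]`. -/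
def pd {k : ℕ} (h : ℕ) (F : N k → ℂ) : N k → ℂ :=
  fun σ => fderiv ℂ F σ (basisVec k h)

/-- The vector field `E = ∑_{h=1}^k σ_h ∂_h`. -/
def eulerOp {k : ℕ} (F : N k → ℂ) : N k → ℂ :=
  fun σ => ∑ i : Fin k, σ i * pd (i.val + 1) F σ

/-- `A_{p,q} = ∂_p ∂_q - ∂_{p+1} ∂_{q-1}`. -/
def opA {k : ℕ} (p q : ℕ) (F : N k → ℂ) : N k → ℂ :=
  fun σ => pd p (pd q F) σ - pd (p + 1) (pd (q - 1) F) σ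

/-- `T^m = ∂_1 ∂_{m-1} + ∂_m E`. -/
def opT {k : ℕ} (m : ℕ) (F : N k → ℂ) : N k → ℂ :=
  fun σ => pd 1 (pd (m - 1) F) σ + pd m (eulerOp F) σ

/-- `T̃^m = T^m + ∂_m`. -/
def opTtilde {k : ℕ} (m : ℕ) (F : N k → ℂ) : N k → ℂ :=
  fun σ => opT m F σ + pd m F σ

/-- `F` is a solution on `N` of the system `S 2)`: it is annihilated by the operators `A_{p,q}`,
`p ∈ [1, k-1]`, `q ∈ [2, k]`, and `T̃^m`, `m ∈ [2, k]`. -/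
def SolvesS2 {k : ℕ} (F : N k → ℂ) : Prop :=
  (∀ p q : ℕ, 1 ≤ p → p + 1 ≤ k → 2 ≤ q → q ≤ k → ∀ σ : N k, opA p q F σ = 0) ∧
  (∀ m : ℕ, 2 ≤ m → m ≤ k → ∀ σ : N k, opTtilde m F σ = 0)

/-- The sum `∑_j g(z_j) / P_σ'(z_j)` over the roots `z_1, …, z_k` of `P_σ`. -/
def traceSum {k : ℕ} (g : ℂ → ℂ) (σ : N k) : ℂ :=
  ((P σ).roots.map fun z => g z / (P σ).derivative.eval z).sum

/-- The equality `G = T̃(g)`: it means that `G(σ) = ∑_j g(z_j) / P_σ'(z_j)` at each `σ` where the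
discriminant of `P_σ` does not vanish. -/
def IsTraceForm {k : ℕ} (g : ℂ → ℂ) (G : N k → ℂ) : Prop :=
  ∀ σ : N k, (P σ).discr ≠ 0 → G σ = traceSum g σ

end TraceForms

end

/-! The trace form of `f` is the sum of the residues of `f / P_σ`, that is, the Cauchy integral
`(2πi)⁻¹ ∮ f / P_σ` over any circle around the roots (`isTraceForm_traceInt`), and this integral is
entire in `σ`. As `σ ↦ P_σ(z)` is affine with `∂_h P_σ(z) = (-1)^h z^(k-h)`, the integrand itself
solves `S 2)` for each fixed `z`; differentiating under the integral gives `opA_polarInt` and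
`opTtilde_polarInt`.

Conversely, `[∂_m, E] = ∂_m` and the vanishing of `E` at the origin turn the equations `T̃^m G = 0`,
differentiated along a list `l`, into `∂_m ∂^l G(0) = -∂_1 ∂_{m-1} ∂^l G(0) / (2 + |l|)`. Iterating,
every Taylor coefficient comes from powers of `∂_1`, so a solution is determined by its values on
the `σ_1`-axis (`SolvesS2.eq_of_axis`). There `P_σ(z) = z^(k-1) (z - s)`, so by Cauchy's formula the
trace form of `z^(k-1) h(z)` takes the value `h(s)` (`traceInt_axis`). Hence `G` is the trace form
of `z^(k-1) G(z, 0, …, 0)`, and the same formula makes `g` unique. A trace form is unique for given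
`f` because the discriminant is non-zero on a dense set. -/

namespace TraceForms

open Complex Metric Set Filter Topology MeasureTheory Polynomial

/-! ### Holomorphic dependence of circle integrals on a parameter. -/

section Parametric

variable {E : Type*} [NormedAddCommGroup E] [NormedSpace ℂ E] [ProperSpace E]

/-- A locally bounded family of holomorphic functions has locally bounded derivatives. -/
theorem exists_norm_fderiv_le {Φ : E → ℂ → ℂ} {U : Set E} {S : Set ℂ} (hU : IsOpen U)
    (hS : IsCompact S) (hc : ContinuousOn (fun p : E × ℂ => Φ p.1 p.2) (U ×ˢ S))
    (hd : ∀ z ∈ S, DifferentiableOn ℂ (fun x => Φ x z) U) {x₀ : E} (hx₀ : x₀ ∈ U) :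
    ∃ s ∈ 𝓝 x₀, s ⊆ U ∧ ∃ C : ℝ, ∀ x ∈ s, ∀ z ∈ S, ‖fderiv ℂ (fun x => Φ x z) x‖ ≤ C := by
  obtain ⟨ε, hε, hεU⟩ := Metric.isOpen_iff.1 hU x₀ hx₀
  have hsub : closedBall x₀ (ε / 2) ⊆ U := (closedBall_subset_ball (by linarith)).trans hεU
  obtain ⟨C, hC⟩ := (((isCompact_closedBall x₀ (ε / 2)).prod hS).exists_bound_of_continuousOn
    (hc.mono (prod_mono hsub subset_rfl)))
  refine ⟨ball x₀ (ε / 4), ball_mem_nhds _ (by positivity),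
    (ball_subset_ball (by linarith)).trans hεU, (2 * C) / (ε / 4), fun x hx z hz => ?_⟩
  have hb : ball x (ε / 4) ⊆ closedBall x₀ (ε / 2) := fun y hy => by
    rw [mem_ball] at hx hy
    rw [mem_closedBall]
    linarith [dist_triangle y x x₀]
  -- Cauchy estimate on a ball of radius `ε / 4`; there `Φ` differs from its central value by at
  -- most `2 * C`.
  refine norm_fderiv_le_div_of_mapsTo_ball ((hd z hz).mono (hb.trans hsub)) ?_ (by positivity)
  intro y hy
  have h1 := hC (y, z) ⟨hb hy, hz⟩
  have h2 := hC (x, z) ⟨hb (mem_ball_self (by positivity)), hz⟩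
  rw [mem_closedBall, dist_eq_norm]
  refine (norm_sub_le _ _).trans ?_
  simp only at h1 h2
  linarith

/-- Differentiation under a circle integral, for integrands holomorphic in the parameter. -/
theorem hasFDerivAt_circleIntegral {Φ : E → ℂ → ℂ} {U : Set E} {R : ℝ} (hR : 0 ≤ R)
    (hU : IsOpen U)
    (hc : ContinuousOn (fun p : E × ℂ => Φ p.1 p.2) (U ×ˢ sphere 0 R))
    (hd : ∀ z ∈ sphere (0 : ℂ) R, DifferentiableOn ℂ (fun x => Φ x z) U) {x₀ : E} (hx₀ : x₀ ∈ U)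
    (hm : StronglyMeasurable fun θ : ℝ => fderiv ℂ (fun x => Φ x (circleMap 0 R θ)) x₀) :
    DifferentiableAt ℂ (fun x => ∮ z in C(0, R), Φ x z) x₀ ∧
      ∀ v, fderiv ℂ (fun x => ∮ z in C(0, R), Φ x z) x₀ v =
        ∮ z in C(0, R), fderiv ℂ (fun x => Φ x z) x₀ v := by
  obtain ⟨s, hs, hsU, C, hC⟩ := exists_norm_fderiv_le hU (isCompact_sphere (0 : ℂ) R) hc hd hx₀
  have hmem : ∀ θ : ℝ, circleMap 0 R θ ∈ sphere (0 : ℂ) R := circleMap_mem_sphere 0 hR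
  have hcont : ∀ x ∈ U, Continuous fun θ : ℝ => deriv (circleMap 0 R) θ • Φ x (circleMap 0 R θ) := by
    intro x hx
    have h1 : Continuous fun θ : ℝ => Φ x (circleMap 0 R θ) :=
      hc.comp_continuous (f := fun θ : ℝ => (x, circleMap 0 R θ)) (by fun_prop)
        fun θ => ⟨hx, hmem θ⟩
    simp only [deriv_circleMap]
    exact ((continuous_circleMap 0 R).mul continuous_const).smul h1
  have hm' : StronglyMeasurable fun θ : ℝ =>
      deriv (circleMap 0 R) θ • fderiv ℂ (fun x => Φ x (circleMap 0 R θ)) x₀ := by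
    have h1 : Continuous fun θ : ℝ => deriv (circleMap 0 R) θ := by
      simp only [deriv_circleMap]
      fun_prop
    exact h1.stronglyMeasurable.smul hm
  have hbd : ∀ θ : ℝ, ∀ x ∈ s,
      ‖deriv (circleMap 0 R) θ • fderiv ℂ (fun x => Φ x (circleMap 0 R θ)) x‖ ≤ R * C := by
    intro θ x hx
    rw [norm_smul]
    have : ‖deriv (circleMap 0 R) θ‖ = R := by simp [deriv_circleMap, abs_of_nonneg hR]
    rw [this]
    exact mul_le_mul_of_nonneg_left (hC x hx _ (hmem θ)) hR
  have hint : IntervalIntegrable (fun θ : ℝ =>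
      deriv (circleMap 0 R) θ • fderiv ℂ (fun x => Φ x (circleMap 0 R θ)) x₀)
      volume 0 (2 * Real.pi) :=
    (intervalIntegrable_const (c := R * C)).mono_fun' hm'.aestronglyMeasurable
      (Eventually.of_forall fun θ => hbd θ x₀ (mem_of_mem_nhds hs))
  have key : HasFDerivAt (fun x => ∮ z in C(0, R), Φ x z)
      (∫ θ in (0 : ℝ)..2 * Real.pi,
        deriv (circleMap 0 R) θ • fderiv ℂ (fun x => Φ x (circleMap 0 R θ)) x₀) x₀ := by
    refine intervalIntegral.hasFDerivAt_integral_of_dominated_of_fderiv_le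
      (F := fun x θ => deriv (circleMap 0 R) θ • Φ x (circleMap 0 R θ))
      (F' := fun x θ => deriv (circleMap 0 R) θ • fderiv ℂ (fun x => Φ x (circleMap 0 R θ)) x)
      (bound := fun _ => R * C) hs ?_ ?_ hm'.aestronglyMeasurable ?_ (by simp) ?_
    · filter_upwards [hs] with x hx
      exact (hcont x (hsU hx)).aestronglyMeasurable
    · exact (hcont x₀ hx₀).intervalIntegrable _ _
    · exact Eventually.of_forall fun θ _ x hx => hbd θ x hx
    · refine Eventually.of_forall fun θ _ x hx => ?_
      exact ((hd _ (hmem θ)).differentiableAt (hU.mem_nhds (hsU hx))).hasFDerivAt.fun_const_smul _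
  refine ⟨key.differentiableAt, fun v => ?_⟩
  rw [key.fderiv, ContinuousLinearMap.intervalIntegral_apply hint]
  simp [circleIntegral]

end Parametric

/-! ### Smoothness of entire functions of several variables. -/

section Entire

variable {E : Type*} [NormedAddCommGroup E] [NormedSpace ℂ E] [FiniteDimensional ℂ E]

/-- A directional derivative is a one-variable derivative at `0`, hence a Cauchy integral of
translates of `F`, which can be differentiated in `x` under the integral sign. -/
theorem differentiable_fderiv_apply {F : E → ℂ} (hF : Differentiable ℂ F) (v : E) :
    Differentiable ℂ fun x => fderiv ℂ F x v := by
  have : ProperSpace E := FiniteDimensional.proper ℂ E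
  have hderiv : ∀ x, HasDerivAt (fun z : ℂ => F (x + z • v)) (fderiv ℂ F x v) 0 := by
    intro x
    have h1 : HasDerivAt (fun z : ℂ => x + z • v) v 0 := by
      simpa using ((hasDerivAt_id (0 : ℂ)).smul_const v).const_add x
    have h2 : HasFDerivAt F (fderiv ℂ F x) (x + (0 : ℂ) • v) := by
      simpa using (hF x).hasFDerivAt
    exact h2.comp_hasDerivAt (0 : ℂ) h1
  have hcauchy : (fun x => fderiv ℂ F x v) = fun x => (2 * Real.pi * I : ℂ)⁻¹ •
      ∮ z in C(0, 1), (1 / z ^ 2) * F (x + z • v) := by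
    funext x
    have hdz : Differentiable ℂ fun z : ℂ => F (x + z • v) := hF.comp (by fun_prop)
    have := DifferentiableOn.deriv_eq_smul_circleIntegral (c := 0) one_pos
      (hdz.differentiableOn (s := closedBall 0 1))
    rw [(hderiv x).deriv] at this
    simp only [sub_zero, smul_eq_mul] at this
    rw [this, smul_eq_mul, inv_mul_cancel_left₀ Complex.two_pi_I_ne_zero]
  rw [hcauchy]
  intro x₀
  refine DifferentiableAt.fun_const_smul ?_ _
  refine (hasFDerivAt_circleIntegral (U := univ) zero_le_one isOpen_univ ?_ ?_ (mem_univ x₀) ?_).1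
  · intro p hp
    have hp0 : p.2 ≠ 0 := by
      intro h
      have := hp.2
      simp [h] at this
    have h2 : ContinuousAt F (p.1 + p.2 • v) := hF.continuous.continuousAt
    have h3 : ContinuousAt (fun q : E × ℂ => F (q.1 + q.2 • v)) p :=
      ContinuousAt.comp (f := fun q : E × ℂ => q.1 + q.2 • v) h2 (by fun_prop)
    exact (ContinuousAt.mul (by fun_prop (disch := simpa using hp0)) h3).continuousWithinAt
  · intro z _
    exact (((hF.comp (differentiable_id.add_const (z • v)))).const_mul _).differentiableOn
  · have hfd : ∀ θ : ℝ, fderiv ℂ (fun x => 1 / (circleMap 0 1 θ) ^ 2 * F (x + circleMap 0 1 θ • v)) x₀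
        = (1 / (circleMap 0 1 θ) ^ 2) • fderiv ℂ F (x₀ + circleMap 0 1 θ • v) := by
      intro θ
      rw [fderiv_const_mul (by exact (hF.comp (differentiable_id.add_const _)) x₀),
        fderiv_comp_add_right]
    simp only [hfd]
    -- Continuity of `fderiv ℂ F` is not yet available at this point; measurability is enough.
    borelize E
    have : SecondCountableTopology (E →L[ℂ] ℂ) := inferInstance
    have m1 : Measurable fun θ : ℝ => fderiv ℂ F (x₀ + circleMap 0 1 θ • v) :=
      (measurable_fderiv ℂ F).comp (by fun_prop : Continuous _).measurable
    have c1 : Continuous fun θ : ℝ => 1 / (circleMap 0 1 θ) ^ 2 := by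
      refine continuous_const.div (by fun_prop) fun θ => ?_
      simp [circleMap]
    exact c1.stronglyMeasurable.smul m1.stronglyMeasurable

theorem contDiff_of_differentiable {F : E → ℂ} (hF : Differentiable ℂ F) (n : ℕ) :
    ContDiff ℂ n F := by
  induction n generalizing F with
  | zero => exact contDiff_zero.2 hF.continuous
  | succ n ih =>
    push_cast
    rw [contDiff_succ_iff_fderiv]
    refine ⟨hF, by simp, contDiff_clm_apply_iff.2 fun v => ih (differentiable_fderiv_apply hF v)⟩

theorem fderiv_fderiv_apply_comm {F : E → ℂ} (hF : Differentiable ℂ F) (v w x : E) :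
    fderiv ℂ (fun y => fderiv ℂ F y v) x w = fderiv ℂ (fun y => fderiv ℂ F y w) x v := by
  have h2 := contDiff_of_differentiable hF 2
  have hd : DifferentiableAt ℂ (fderiv ℂ F) x :=
    ((h2.fderiv_right (m := 1) (by norm_num)).differentiable (by norm_num)) x
  rw [fderiv_clm_apply hd (by fun_prop), fderiv_clm_apply hd (by fun_prop)]
  simpa using (h2.contDiffAt.isSymmSndFDerivAt (by simp)) w v

end Entire

/-! ### Commutation of the partial derivatives with each other and with `E`. -/

variable {k : ℕ}

theorem differentiable_pd {F : N k → ℂ} (hF : Differentiable ℂ F) (h : ℕ) :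
    Differentiable ℂ (pd h F) :=
  differentiable_fderiv_apply hF _

theorem pd_comm {F : N k → ℂ} (hF : Differentiable ℂ F) (p q : ℕ) :
    pd p (pd q F) = pd q (pd p F) :=
  funext fun σ => fderiv_fderiv_apply_comm hF (basisVec k q) (basisVec k p) σ

theorem sum_smul_basisVec (v : N k) : ∑ i : Fin k, v i • basisVec k (i.val + 1) = v := by
  funext j
  simp [basisVec, Fin.val_inj]

theorem fderiv_eq_sum_pd (F : N k → ℂ) (σ v : N k) :
    fderiv ℂ F σ v = ∑ i : Fin k, v i * pd (i.val + 1) F σ := by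
  conv_lhs => rw [← sum_smul_basisVec v]
  simp [pd]

theorem pd_sub {F G : N k → ℂ} (hF : Differentiable ℂ F) (hG : Differentiable ℂ G) (h : ℕ) :
    pd h (F - G) = pd h F - pd h G := by
  funext σ
  simp [pd, fderiv_sub (hF σ) (hG σ)]

theorem eulerOp_sub {F G : N k → ℂ} (hF : Differentiable ℂ F) (hG : Differentiable ℂ G) :
    eulerOp (F - G) = eulerOp F - eulerOp G := by
  funext σ
  simp [eulerOp, pd_sub hF hG, mul_sub, Finset.sum_sub_distrib]

theorem differentiable_eulerOp {F : N k → ℂ} (hF : Differentiable ℂ F) :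
    Differentiable ℂ (eulerOp F) := by
  have h := fun i : Fin k => differentiable_pd hF (i.val + 1)
  unfold eulerOp
  fun_prop

/-- The product rule on `σ_i ∂_i F`: the commutator `[∂_m, E]` is `∂_m`. -/
theorem pd_eulerOp {F : N k → ℂ} (hF : Differentiable ℂ F) (m : ℕ) :
    pd m (eulerOp F) = pd m F + eulerOp (pd m F) := by
  have h := fun i : Fin k => differentiable_pd hF (i.val + 1)
  funext σ
  have hi : ∀ i : Fin k, HasFDerivAt (fun σ : N k => σ i * pd (i.val + 1) F σ)
      (σ i • fderiv ℂ (pd (i.val + 1) F) σ +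
        pd (i.val + 1) F σ • (ContinuousLinearMap.proj i : N k →L[ℂ] ℂ)) σ := fun i =>
    (hasFDerivAt_apply i σ).mul (h i σ).hasFDerivAt
  have hs := HasFDerivAt.fun_sum fun i (_ : i ∈ Finset.univ) => hi i
  have hE : pd m (eulerOp F) σ = _ := congrArg (fun L => L (basisVec k m)) hs.fderiv
  have hm : pd m F σ = _ := fderiv_eq_sum_pd F σ (basisVec k m)
  rw [hE, Pi.add_apply, hm, eulerOp, ← Finset.sum_add_distrib]
  simp only [_root_.sum_apply]
  refine Finset.sum_congr rfl fun i _ => ?_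
  rw [pd_comm hF]
  simp [pd]
  ring

/-- The equations obtained from `T̃^m F = 0`, for `c = 2`, by moving `E` to the left of `∂_m`;
differentiation raises the parameter `c` by one. -/
def SolvesShifted (c : ℂ) (F : N k → ℂ) : Prop :=
  ∀ m : ℕ, 2 ≤ m → m ≤ k → ∀ σ : N k,
    pd 1 (pd (m - 1) F) σ + eulerOp (pd m F) σ + c * pd m F σ = 0

theorem opTtilde_eq {F : N k → ℂ} (hF : Differentiable ℂ F) (m : ℕ) (σ : N k) :
    opTtilde m F σ = pd 1 (pd (m - 1) F) σ + eulerOp (pd m F) σ + 2 * pd m F σ := by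
  rw [opTtilde, opT, pd_eulerOp hF, Pi.add_apply]
  ring

/-- Moving `∂_j` past `E` leaves one extra `∂_j ∂_m F`, which is absorbed in the constant. -/
theorem SolvesShifted.pd {c : ℂ} {F : N k → ℂ} (hF : Differentiable ℂ F)
    (h : SolvesShifted c F) (j : ℕ) : SolvesShifted (c + 1) (pd j F) := by
  intro m hm hmk σ
  have h1 := differentiable_pd (differentiable_pd hF (m - 1)) 1
  have hm' := differentiable_pd hF m
  have h2 := differentiable_eulerOp hm'
  have hz : TraceForms.pd j (fun σ => TraceForms.pd 1 (TraceForms.pd (m - 1) F) σ +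
      eulerOp (TraceForms.pd m F) σ + c * TraceForms.pd m F σ) σ = 0 := by
    simp only [h m hm hmk]
    simp [TraceForms.pd]
  have hsum : TraceForms.pd j (fun σ => TraceForms.pd 1 (TraceForms.pd (m - 1) F) σ +
      eulerOp (TraceForms.pd m F) σ + c * TraceForms.pd m F σ) σ =
      TraceForms.pd j (TraceForms.pd 1 (TraceForms.pd (m - 1) F)) σ +
        TraceForms.pd j (eulerOp (TraceForms.pd m F)) σ +
        c * TraceForms.pd j (TraceForms.pd m F) σ := by
    rw [TraceForms.pd, fderiv_fun_add ((h1 σ).fun_add (h2 σ)) ((hm' σ).const_mul c),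
      fderiv_fun_add (h1 σ) (h2 σ), fderiv_const_mul (hm' σ)]
    simp [TraceForms.pd]
  rw [hsum, pd_eulerOp hm', pd_comm (differentiable_pd hF _) j 1, pd_comm hF j (m - 1),
    pd_comm hF j m, Pi.add_apply] at hz
  linear_combination hz

/-! ### Taylor coefficients at the origin and determination by the first axis. -/

/-- The iterated partial derivative along a list of indices. -/
noncomputable def iterPd (l : List ℕ) (F : N k → ℂ) : N k → ℂ := l.foldr pd F

theorem differentiable_iterPd {F : N k → ℂ} (hF : Differentiable ℂ F) (l : List ℕ) :
    Differentiable ℂ (iterPd l F) := by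
  induction l with
  | nil => exact hF
  | cons a l ih => exact differentiable_pd ih a

theorem iterPd_perm {F : N k → ℂ} (hF : Differentiable ℂ F) {l l' : List ℕ} (h : l.Perm l') :
    iterPd l F = iterPd l' F := by
  induction h with
  | nil => rfl
  | cons a _ ih => exact congrArg (pd a) ih
  | swap a b l => exact pd_comm (differentiable_iterPd hF l) b a
  | trans _ _ ih₁ ih₂ => exact ih₁.trans ih₂

theorem SolvesShifted.iterPd {c : ℂ} {F : N k → ℂ} (hF : Differentiable ℂ F)
    (h : SolvesShifted c F) (l : List ℕ) :
    SolvesShifted (c + l.length) (iterPd l F) := by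
  induction l with
  | nil => simpa [TraceForms.iterPd] using h
  | cons a l ih =>
    have := ih.pd (differentiable_iterPd hF l) a
    rw [List.length_cons, Nat.cast_succ, ← add_assoc]
    exact this

theorem pd_one_eq_zero_of_axis {F : N k → ℂ} (hF : Differentiable ℂ F)
    (h : ∀ s : ℂ, F (s • basisVec k 1) = 0) (s : ℂ) : pd 1 F (s • basisVec k 1) = 0 := by
  have h1 : HasDerivAt (fun z : ℂ => z • basisVec k 1) (basisVec k 1) s := by
    simpa using (hasDerivAt_id s).smul_const (basisVec k 1)
  have h2 := (hF (s • basisVec k 1)).hasFDerivAt.comp_hasDerivAt s h1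
  have h3 : (F ∘ fun z : ℂ => z • basisVec k 1) = fun _ => 0 := funext h
  rw [h3] at h2
  exact h2.unique (hasDerivAt_const s 0)

theorem iterPd_replicate_one_axis {F : N k → ℂ} (hF : Differentiable ℂ F)
    (h : ∀ s : ℂ, F (s • basisVec k 1) = 0) (n : ℕ) (s : ℂ) :
    iterPd (List.replicate n 1) F (s • basisVec k 1) = 0 := by
  induction n generalizing s with
  | zero => exact h s
  | succ n ih => exact pd_one_eq_zero_of_axis (differentiable_iterPd hF _) ih s

/-- The equations `T̃^m F = 0` express every Taylor coefficient at the origin through those along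
the first axis. -/
theorem iterPd_apply_zero {F : N k → ℂ} (hF : Differentiable ℂ F) (hS : SolvesShifted 2 F)
    (h : ∀ s : ℂ, F (s • basisVec k 1) = 0) (d : ℕ) (l : List ℕ)
    (hl : ∀ a ∈ l, 1 ≤ a ∧ a ≤ k) (hd : l.sum ≤ l.length + d) : iterPd l F 0 = 0 := by
  induction d generalizing l with
  | zero =>
    have hone : ∀ a ∈ l, a = 1 := by
      clear hS
      induction l with
      | nil => simp
      | cons a l ih =>
        -- With entries at least `1`, a sum not exceeding the length forces every entry to be `1`.
        have hlen : l.length ≤ l.sum := by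
          simpa using List.card_nsmul_le_sum l 1 fun x hx => (hl x (by simp [hx])).1
        have ha := (hl a (by simp)).1
        simp only [List.sum_cons, List.length_cons] at hd
        intro x hx
        rcases List.mem_cons.1 hx with rfl | hx
        · omega
        · exact ih (fun y hy => hl y (by simp [hy])) (by omega) x hx
    rw [List.eq_replicate_of_mem hone]
    simpa using iterPd_replicate_one_axis hF h l.length 0
  | succ d ih =>
    by_cases hone : ∀ a ∈ l, a = 1
    · rw [List.eq_replicate_of_mem hone]
      simpa using iterPd_replicate_one_axis hF h l.length 0
    · push Not at hone
      obtain ⟨m, hml, hm1⟩ := hone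
      have hperm := List.perm_cons_erase hml
      have hm := hl m hml
      have hsum := hperm.sum_eq
      have hlen := hperm.length_eq
      simp only [List.sum_cons, List.length_cons] at hsum hlen
      rw [iterPd_perm hF hperm]
      have hz := hS.iterPd hF (l.erase m) m (by omega) hm.2 0
      -- Splitting `m` into `1` and `m - 1` keeps the sum and lengthens the list by one, so the
      -- excess of sum over length drops.
      have h0 : iterPd (1 :: (m - 1) :: l.erase m) F 0 = 0 := by
        refine ih _ ?_ ?_
        · intro a ha
          simp only [List.mem_cons] at ha
          rcases ha with rfl | rfl | ha
          · omega
          · omega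
          · exact hl a (List.mem_of_mem_erase ha)
        · simp only [List.sum_cons, List.length_cons]
          omega
      have h0' : pd 1 (pd (m - 1) (iterPd (l.erase m) F)) 0 = 0 := h0
      have hE : eulerOp (pd m (iterPd (l.erase m) F)) 0 = 0 := by simp [eulerOp]
      rw [h0', hE, zero_add, zero_add] at hz
      -- Only the last term survives at the origin, and its coefficient is a positive integer.
      refine (mul_eq_zero.1 hz).resolve_left ?_
      have : ((2 + (l.erase m).length : ℕ) : ℂ) ≠ 0 := Nat.cast_ne_zero.2 (by omega)
      exact_mod_cast this

theorem hasDerivAt_comp_smul {F : N k → ℂ} (hF : Differentiable ℂ F) (σ : N k) (t : ℂ) :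
    HasDerivAt (fun t : ℂ => F (t • σ)) (∑ i : Fin k, σ i * pd (i.val + 1) F (t • σ)) t := by
  rw [← fderiv_eq_sum_pd]
  have h1 : HasDerivAt (fun z : ℂ => z • σ) σ t := by
    simpa using (hasDerivAt_id t).smul_const σ
  exact (hF (t • σ)).hasFDerivAt.comp_hasDerivAt t h1

theorem iteratedDeriv_comp_smul_eq_zero {F : N k → ℂ} (hF : Differentiable ℂ F)
    (h : ∀ l : List ℕ, (∀ a ∈ l, 1 ≤ a ∧ a ≤ k) → iterPd l F 0 = 0) (σ : N k) (n : ℕ) :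
    iteratedDeriv n (fun t : ℂ => F (t • σ)) 0 = 0 := by
  induction n generalizing F with
  | zero => simpa [iterPd] using h [] (by simp)
  | succ n ih =>
    rw [iteratedDeriv_succ']
    have hd : deriv (fun t : ℂ => F (t • σ)) =
        fun t : ℂ => ∑ i : Fin k, σ i * pd (i.val + 1) F (t • σ) :=
      funext fun t => (hasDerivAt_comp_smul hF σ t).deriv
    have hi : ∀ i : Fin k, Differentiable ℂ fun t : ℂ => pd (i.val + 1) F (t • σ) := fun i =>
      (differentiable_pd hF _).comp (by fun_prop)
    rw [hd, iteratedDeriv_fun_sum fun i _ => ((hi i).const_mul _).contDiff.contDiffAt]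
    refine Finset.sum_eq_zero fun i _ => ?_
    rw [iteratedDeriv_const_mul_field, ih (differentiable_pd hF _), mul_zero]
    intro l hl
    -- The last entry of a list is the innermost derivative, so appending means applying `l` to `pd
    -- (i.val + 1) F`.
    have := h (l ++ [i.val + 1]) (by
      intro a ha
      rcases List.mem_append.1 ha with ha | ha
      · exact hl a ha
      · have := i.isLt
        simp only [List.mem_singleton] at ha
        omega)
    simpa [iterPd] using this

/-- On each complex line through the origin, `F` is an entire function of one variable with zero
Taylor series. -/
theorem eq_zero_of_iterPd_eq_zero {F : N k → ℂ} (hF : Differentiable ℂ F)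
    (h : ∀ l : List ℕ, (∀ a ∈ l, 1 ≤ a ∧ a ≤ k) → iterPd l F 0 = 0) : F = 0 := by
  funext σ
  have hφ : Differentiable ℂ fun t : ℂ => F (t • σ) := hF.comp (by fun_prop)
  have := Complex.taylorSeries_eq_of_entire' 0 1 hφ
  simp only [iteratedDeriv_comp_smul_eq_zero hF h σ] at this
  simpa using this.symm

/-- A solution of `S 2)` is determined by its restriction to the first axis. -/
theorem SolvesS2.eq_of_axis {F G : N k → ℂ} (hF : Differentiable ℂ F) (hG : Differentiable ℂ G)
    (hFS : SolvesS2 F) (hGS : SolvesS2 G)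
    (h : ∀ s : ℂ, F (s • basisVec k 1) = G (s • basisVec k 1)) : F = G := by
  rw [← sub_eq_zero]
  have hd := hF.sub hG
  have hS : SolvesShifted 2 (F - G) := by
    intro m hm hmk σ
    have h1 := hFS.2 m hm hmk σ
    have h2 := hGS.2 m hm hmk σ
    rw [opTtilde_eq hF] at h1
    rw [opTtilde_eq hG] at h2
    rw [pd_sub hF hG, pd_sub hF hG, eulerOp_sub (differentiable_pd hF m) (differentiable_pd hG m),
      pd_sub (differentiable_pd hF _) (differentiable_pd hG _)]
    simp only [Pi.sub_apply]
    linear_combination h1 - h2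
  exact eq_zero_of_iterPd_eq_zero hd fun l hl =>
    iterPd_apply_zero hd hS (fun s => by simp [h s]) l.sum l hl (by omega)

/-! ### `P_σ(z)` as an affine function of `σ`, and a bound for the roots. -/

/-- The linear part `σ ↦ ∑_h (-1)^h σ_h z^(k-h)` of `σ ↦ P_σ(z)`. -/
noncomputable def evalLin (k : ℕ) (z : ℂ) : N k →L[ℂ] ℂ :=
  ∑ i : Fin k, ((-1) ^ (i.val + 1) * z ^ (k - (i.val + 1))) •
    (ContinuousLinearMap.proj i : N k →L[ℂ] ℂ)

theorem evalLin_apply (z : ℂ) (σ : N k) :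
    evalLin k z σ = ∑ i : Fin k, (-1) ^ (i.val + 1) * z ^ (k - (i.val + 1)) * σ i := by
  simp [evalLin]

theorem continuous_evalLin : Continuous (evalLin k) := by
  unfold evalLin
  fun_prop

theorem eval_P (σ : N k) (z : ℂ) : (P σ).eval z = z ^ k + evalLin k z σ := by
  rw [evalLin_apply, P, eval_add, eval_pow, eval_X, eval_finsetSum]
  simp only [eval_mul, eval_C, eval_pow, eval_X]
  congr 1
  exact Finset.sum_congr rfl fun i _ => by ring

theorem evalLin_basisVec {h : ℕ} (h1 : 1 ≤ h) (hk : h ≤ k) (z : ℂ) :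
    evalLin k z (basisVec k h) = (-1) ^ h * z ^ (k - h) := by
  rw [evalLin_apply, Finset.sum_eq_single (⟨h - 1, by omega⟩ : Fin k)]
  · have : h - 1 + 1 = h := by omega
    simp [basisVec, this]
  · intro i _ hi
    have : i.val + 1 ≠ h := fun e => hi (Fin.ext (by simp; omega))
    simp [basisVec, this]
  · simp

theorem norm_evalLin_le {z : ℂ} (hz : 1 ≤ ‖z‖) (σ : N k) :
    ‖evalLin k z σ‖ ≤ k * ‖σ‖ * ‖z‖ ^ (k - 1) := by
  rw [evalLin_apply]
  refine (norm_sum_le _ _).trans ?_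
  have : ∀ i ∈ (Finset.univ : Finset (Fin k)),
      ‖(-1 : ℂ) ^ (i.val + 1) * z ^ (k - (i.val + 1)) * σ i‖ ≤ ‖z‖ ^ (k - 1) * ‖σ‖ := by
    intro i _
    rw [norm_mul, norm_mul, norm_pow, norm_pow, norm_neg, norm_one, one_pow, one_mul]
    exact mul_le_mul (pow_le_pow_right₀ hz (by omega)) (norm_le_pi_norm σ i) (norm_nonneg _)
      (by positivity)
  refine (Finset.sum_le_card_nsmul _ _ _ this).trans (le_of_eq ?_)
  simp
  ring

/-- At a root, `|z|^k` would equal the size of the linear part, which is at most `k ‖σ‖ |z|^(k-1)`.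
-/
theorem eval_P_ne_zero {z : ℂ} (hz : 1 ≤ ‖z‖) {σ : N k} (h : k * ‖σ‖ < ‖z‖) :
    (P σ).eval z ≠ 0 := by
  rcases Nat.eq_zero_or_pos k with rfl | hk
  · simp [eval_P, evalLin_apply]
  intro h0
  rw [eval_P, add_eq_zero_iff_eq_neg] at h0
  have h1 := congrArg norm h0
  rw [norm_neg, norm_pow] at h1
  have h2 := norm_evalLin_le hz σ
  have h3 : ‖z‖ ^ k = ‖z‖ * ‖z‖ ^ (k - 1) := by
    rw [← pow_succ', Nat.sub_add_cancel hk]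
  have h4 : (0 : ℝ) < ‖z‖ ^ (k - 1) := by positivity
  have h5 := mul_lt_mul_of_pos_right h h4
  linarith

/-! ### Integrals of `φ / P_σ ^ n` and the operators of the system. -/

/-- The integral of `φ / P_σ ^ n` over the circle of radius `R` about the origin. -/
noncomputable def polarInt (φ : ℂ → ℂ) (n : ℕ) (R : ℝ) (σ : N k) : ℂ :=
  ∮ z in C(0, R), φ z * ((P σ).eval z)⁻¹ ^ n

/-- The parameters `σ` for which an elementary bound puts the roots of `P_σ` inside the circle of
radius `R`. -/
def smallParams (k : ℕ) (R : ℝ) : Set (N k) := {σ | k * ‖σ‖ < R}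

theorem mem_smallParams {R : ℝ} {σ : N k} : σ ∈ smallParams k R ↔ k * ‖σ‖ < R := Iff.rfl

theorem isOpen_smallParams (R : ℝ) : IsOpen (smallParams k R) :=
  isOpen_lt (by fun_prop) continuous_const

theorem eval_P_ne_zero_of_mem {R : ℝ} (hR : 1 ≤ R) {σ : N k} (hσ : σ ∈ smallParams k R) {z : ℂ}
    (hz : R ≤ ‖z‖) : (P σ).eval z ≠ 0 :=
  eval_P_ne_zero (hR.trans hz) (lt_of_lt_of_le hσ hz)

theorem hasFDerivAt_polar_integrand (c : ℂ) (n : ℕ) {σ : N k} {z : ℂ}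
    (h : (P σ).eval z ≠ 0) :
    HasFDerivAt (fun τ : N k => c * ((P τ).eval z)⁻¹ ^ n)
      ((-n * c * ((P σ).eval z)⁻¹ ^ (n + 1)) • evalLin k z) σ := by
  have h1 : HasFDerivAt (fun τ : N k => (P τ).eval z) (evalLin k z) σ := by
    simp only [eval_P]
    exact (evalLin k z).hasFDerivAt.const_add _
  have h2 : HasDerivAt (fun w : ℂ => c * w⁻¹ ^ n) (-n * c * ((P σ).eval z)⁻¹ ^ (n + 1))
      ((P σ).eval z) := by
    refine (((hasDerivAt_inv h).fun_pow n).const_mul c).congr_deriv ?_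
    rcases n with _ | n
    · simp
    · simp only [Nat.add_sub_cancel, inv_pow]
      field_simp
      ring
  exact HasDerivAt.comp_hasFDerivAt (h₂ := fun w : ℂ => c * w⁻¹ ^ n) σ h2 h1

theorem polarInt_fderiv {φ : ℂ → ℂ} (hφ : Continuous φ) (n : ℕ) {R : ℝ} (hR : 1 ≤ R) {σ : N k}
    (hσ : σ ∈ smallParams k R) :
    DifferentiableAt ℂ (polarInt φ n R) σ ∧ ∀ v : N k, fderiv ℂ (polarInt φ n R) σ v =
      ∮ z in C(0, R), -n * φ z * ((P σ).eval z)⁻¹ ^ (n + 1) * evalLin k z v := by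
  have hR0 : 0 ≤ R := zero_le_one.trans hR
  have hne : ∀ τ ∈ smallParams k R, ∀ z ∈ sphere (0 : ℂ) R, (P τ).eval z ≠ 0 := fun τ hτ z hz =>
    eval_P_ne_zero_of_mem hR hτ (by simp at hz; rw [hz])
  have hcP : Continuous fun p : N k × ℂ => (P p.1).eval p.2 := by
    simp only [eval_P, evalLin_apply]
    fun_prop
  have hcd : ContinuousOn (fun p : N k × ℂ => φ p.2 * ((P p.1).eval p.2)⁻¹ ^ n)
      (smallParams k R ×ˢ sphere 0 R) :=
    ContinuousOn.mul (hφ.comp continuous_snd).continuousOn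
      ((hcP.continuousOn.inv₀ fun p hp => hne p.1 hp.1 p.2 hp.2).pow n)
  have hm : StronglyMeasurable fun θ : ℝ => fderiv ℂ (fun τ : N k =>
      φ (circleMap 0 R θ) * ((P τ).eval (circleMap 0 R θ))⁻¹ ^ n) σ := by
    have hc : ∀ θ : ℝ, (P σ).eval (circleMap 0 R θ) ≠ 0 := fun θ =>
      hne σ hσ _ (circleMap_mem_sphere 0 hR0 θ)
    have hfd := fun θ : ℝ => (hasFDerivAt_polar_integrand (φ (circleMap 0 R θ)) n (hc θ)).fderiv
    simp only [hfd]
    refine Continuous.stronglyMeasurable ?_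
    have hcm := continuous_circleMap 0 R
    refine Continuous.smul (.mul (continuous_const.mul (hφ.comp hcm)) ?_)
      (continuous_evalLin.comp hcm)
    exact (((P σ).continuous.comp hcm).inv₀ hc).pow _
  obtain ⟨h1, h2⟩ := hasFDerivAt_circleIntegral
    (Φ := fun (τ : N k) z => φ z * ((P τ).eval z)⁻¹ ^ n) hR0 (isOpen_smallParams (k := k) R) hcd
    (fun z hz τ hτ => (hasFDerivAt_polar_integrand (φ z) n
      (hne τ hτ z hz)).differentiableAt.differentiableWithinAt) hσ hm
  refine ⟨h1, fun v => (h2 v).trans (circleIntegral.integral_congr hR0 fun z hz => ?_)⟩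
  rw [(hasFDerivAt_polar_integrand (φ z) n (hne σ hσ z hz)).fderiv]
  simp

theorem pd_polarInt {φ : ℂ → ℂ} (hφ : Continuous φ) (n : ℕ) {R : ℝ} (hR : 1 ≤ R) {σ : N k}
    (hσ : σ ∈ smallParams k R) {h : ℕ} (h1 : 1 ≤ h) (hk : h ≤ k) :
    pd h (polarInt φ n R) σ =
      polarInt (fun z => -n * ((-1) ^ h * z ^ (k - h)) * φ z) (n + 1) R σ := by
  rw [pd, (polarInt_fderiv hφ n hR hσ).2, polarInt]
  congr 1
  funext z
  rw [evalLin_basisVec h1 hk]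
  ring

theorem polarInt_neg (φ : ℂ → ℂ) (n : ℕ) (R : ℝ) (σ : N k) :
    polarInt (fun z => -φ z) n R σ = -polarInt φ n R σ := by
  simp only [polarInt, circleIntegral, neg_mul, smul_neg, intervalIntegral.integral_neg]

theorem circleIntegrable_polar {φ : ℂ → ℂ} (hφ : Continuous φ) (n : ℕ) {R : ℝ} (hR : 1 ≤ R)
    {σ : N k} (hσ : σ ∈ smallParams k R) :
    CircleIntegrable (fun z => φ z * ((P σ).eval z)⁻¹ ^ n) 0 R := by
  refine ContinuousOn.circleIntegrable (zero_le_one.trans hR) ?_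
  refine hφ.continuousOn.mul (((P σ).continuous.continuousOn.inv₀ fun z hz => ?_).pow n)
  exact eval_P_ne_zero_of_mem hR hσ (by simp at hz; rw [hz])

/-- The linear part of `P_σ(z)` is `P_σ(z) - z^k`, so `E(1 / P_σ) = z^k / P_σ^2 - 1 / P_σ`. -/
theorem eulerOp_polarInt_one {φ : ℂ → ℂ} (hφ : Continuous φ) {R : ℝ} (hR : 1 ≤ R) {σ : N k}
    (hσ : σ ∈ smallParams k R) :
    eulerOp (polarInt φ 1 R) σ =
      polarInt (fun z => z ^ k * φ z) 2 R σ - polarInt φ 1 R σ := by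
  rw [eulerOp, ← fderiv_eq_sum_pd, (polarInt_fderiv hφ 1 hR hσ).2, polarInt, polarInt,
    ← circleIntegral.integral_sub (circleIntegrable_polar (by fun_prop) 2 hR hσ)
      (circleIntegrable_polar hφ 1 hR hσ)]
  refine circleIntegral.integral_congr (zero_le_one.trans hR) fun z hz => ?_
  have hne : (P σ).eval z ≠ 0 := eval_P_ne_zero_of_mem hR hσ (by simp at hz; rw [hz])
  have hl : evalLin k z σ = (P σ).eval z - z ^ k := by rw [eval_P]; ring
  simp only [hl, inv_pow]
  field_simp
  push_cast
  ring

theorem pd_congr {F G : N k → ℂ} {U : Set (N k)} (hU : IsOpen U) (h : EqOn F G U) (j : ℕ) :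
    EqOn (pd j F) (pd j G) U := fun σ hσ => by
  rw [pd, pd, (h.eventuallyEq_of_mem (hU.mem_nhds hσ)).fderiv_eq]

theorem eulerOp_congr {F G : N k → ℂ} {U : Set (N k)} (hU : IsOpen U) (h : EqOn F G U) :
    EqOn (eulerOp F) (eulerOp G) U := fun σ hσ =>
  Finset.sum_congr rfl fun i _ => by rw [pd_congr hU h _ hσ]

theorem pd_pd_polarInt {φ : ℂ → ℂ} (hφ : Continuous φ) {R : ℝ} (hR : 1 ≤ R) {σ : N k}
    (hσ : σ ∈ smallParams k R) {p q : ℕ} (hp : 1 ≤ p) (hpk : p ≤ k) (hq : 1 ≤ q) (hqk : q ≤ k) :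
    pd p (pd q (polarInt φ 1 R)) σ =
      polarInt (fun z => 2 * ((-1) ^ (p + q) * z ^ (2 * k - (p + q))) * φ z) 3 R σ := by
  rw [pd_congr (isOpen_smallParams R) (fun τ hτ => pd_polarInt hφ 1 hR hτ hq hqk) p hσ,
    pd_polarInt (by fun_prop) 2 hR hσ hp hpk]
  congr 1
  funext z
  have : 2 * k - (p + q) = (k - p) + (k - q) := by omega
  rw [this]
  push_cast
  ring

/-- The second derivatives depend on `p` and `q` only through `p + q`, which `A_{p,q}` leaves
unchanged. -/
theorem opA_polarInt {φ : ℂ → ℂ} (hφ : Continuous φ) {R : ℝ} (hR : 1 ≤ R) {σ : N k}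
    (hσ : σ ∈ smallParams k R) {p q : ℕ} (hp : 1 ≤ p) (hpk : p + 1 ≤ k) (hq : 2 ≤ q)
    (hqk : q ≤ k) : opA p q (polarInt φ 1 R) σ = 0 := by
  rw [opA, pd_pd_polarInt hφ hR hσ hp (by omega) (by omega) hqk,
    pd_pd_polarInt hφ hR hσ (by omega) hpk (by omega) (by omega)]
  have : p + 1 + (q - 1) = p + q := by omega
  rw [this, sub_self]

/-- Applying `∂_m` to the formula for `E` gives two terms: the `z^k / P_σ^2` part cancels `∂_1
∂_{m-1}`, and the `-1 / P_σ` part cancels the added `∂_m`. -/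
theorem opTtilde_polarInt {φ : ℂ → ℂ} (hφ : Continuous φ) {R : ℝ} (hR : 1 ≤ R) {σ : N k}
    (hσ : σ ∈ smallParams k R) {m : ℕ} (hm : 2 ≤ m) (hmk : m ≤ k) :
    opTtilde m (polarInt φ 1 R) σ = 0 := by
  have hφ' : Continuous fun z => z ^ k * φ z := by fun_prop
  have hE : pd m (eulerOp (polarInt φ 1 R)) σ =
      polarInt (fun z => -(2 * ((-1) ^ (1 + (m - 1)) * z ^ (2 * k - (1 + (m - 1)))) * φ z)) 3 R σ
        - pd m (polarInt φ 1 R) σ := by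
    rw [pd_congr (isOpen_smallParams R) (fun τ hτ => eulerOp_polarInt_one hφ hR hτ) m hσ]
    have hs : pd m (fun τ => polarInt (fun z => z ^ k * φ z) 2 R τ - polarInt φ 1 R τ) σ =
        pd m (polarInt (fun z => z ^ k * φ z) 2 R) σ - pd m (polarInt φ 1 R) σ := by
      rw [pd, fderiv_fun_sub (polarInt_fderiv hφ' 2 hR hσ).1 (polarInt_fderiv hφ 1 hR hσ).1]
      rfl
    rw [hs, pd_polarInt hφ' 2 hR hσ (by omega) hmk]
    congr 2
    funext z
    have h1 : 1 + (m - 1) = m := by omega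
    have h2 : 2 * k - m = (k - m) + k := by omega
    rw [h1, h2]
    push_cast
    ring
  rw [opTtilde, opT, hE, pd_pd_polarInt hφ hR hσ le_rfl (by omega) (by omega) (by omega),
    polarInt_neg]
  ring

/-! ### The trace form as an entire function solving the system. -/

/-- The entire extension of the trace form of `f`, as a Cauchy integral over a circle enclosing
the roots. -/
noncomputable def traceInt (f : ℂ → ℂ) (σ : N k) : ℂ :=
  polarInt (fun z => (2 * Real.pi * I)⁻¹ * f z) 1 (1 + k * ‖σ‖) σ

/-- The integrand is holomorphic on the closed annulus between the circles, since all roots lie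
inside the smaller one. This permits a radius that is locally constant in `σ`, as differentiation
requires. -/
theorem polarInt_one_radius {φ : ℂ → ℂ} (hφ : Differentiable ℂ φ) {r R : ℝ} (hr : 1 ≤ r)
    (hrR : r ≤ R) {σ : N k} (hσ : σ ∈ smallParams k r) :
    polarInt φ 1 R σ = polarInt φ 1 r σ := by
  have hd : ∀ z : ℂ, r ≤ ‖z‖ → DifferentiableAt ℂ (fun z => φ z * ((P σ).eval z)⁻¹ ^ 1) z :=
    fun z hz => (hφ z).mul
      (((P σ).differentiable z).fun_inv (eval_P_ne_zero_of_mem hr hσ hz) |>.fun_pow 1)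
  refine circleIntegral_eq_of_differentiable_on_annulus_off_countable (s := ∅) (by linarith) hrR
    countable_empty (fun z hz => (hd z ?_).continuousAt.continuousWithinAt) fun z hz => hd z ?_
  · simpa using hz.2
  · have := hz.1.2
    simp at this
    exact this.le

theorem traceInt_eq {f : ℂ → ℂ} (hf : Differentiable ℂ f) {R : ℝ} (hR : 1 ≤ R) {σ : N k}
    (hσ : σ ∈ smallParams k R) :
    traceInt f σ = polarInt (fun z => (2 * Real.pi * I)⁻¹ * f z) 1 R σ := by
  have hφ : Differentiable ℂ fun z => (2 * Real.pi * I)⁻¹ * f z := hf.const_mul _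
  have h1 : 1 ≤ 1 + k * ‖σ‖ := le_add_of_nonneg_right (by positivity)
  have h2 : σ ∈ smallParams k (1 + k * ‖σ‖) := mem_smallParams.2 (lt_one_add _)
  rcases le_total R (1 + k * ‖σ‖) with h | h
  · exact polarInt_one_radius hφ hR h hσ
  · exact (polarInt_one_radius hφ h1 h h2).symm

theorem exists_mem_smallParams (σ : N k) : ∃ R : ℝ, 1 ≤ R ∧ σ ∈ smallParams k R :=
  ⟨1 + k * ‖σ‖, le_add_of_nonneg_right (by positivity), mem_smallParams.2 (lt_one_add _)⟩

theorem differentiable_traceInt {f : ℂ → ℂ} (hf : Differentiable ℂ f) :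
    Differentiable ℂ (traceInt f : N k → ℂ) := by
  intro σ
  obtain ⟨R, hR, hσ⟩ := exists_mem_smallParams σ
  refine (polarInt_fderiv (φ := fun z => (2 * Real.pi * I)⁻¹ * f z) ?_ 1 hR
    hσ).1.congr_of_eventuallyEq ?_
  · exact hf.continuous.const_mul _
  · filter_upwards [(isOpen_smallParams R).mem_nhds hσ] with τ hτ
    exact traceInt_eq hf hR hτ

theorem solvesS2_traceInt {f : ℂ → ℂ} (hf : Differentiable ℂ f) :
    SolvesS2 (traceInt f : N k → ℂ) := by
  have hφ : Continuous fun z => (2 * Real.pi * I)⁻¹ * f z := hf.continuous.const_mul _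
  constructor
  · intro p q hp hpk hq hqk σ
    obtain ⟨R, hR, hσ⟩ := exists_mem_smallParams σ
    have hU := isOpen_smallParams (k := k) R
    have heq : EqOn (traceInt f) (polarInt (fun z => (2 * Real.pi * I)⁻¹ * f z) 1 R)
        (smallParams k R) := fun τ hτ => traceInt_eq hf hR hτ
    have h := opA_polarInt hφ hR hσ hp hpk hq hqk
    rw [opA] at h ⊢
    rw [pd_congr hU (pd_congr hU heq _) _ hσ, pd_congr hU (pd_congr hU heq _) _ hσ, h]
  · intro m hm hmk σ
    obtain ⟨R, hR, hσ⟩ := exists_mem_smallParams σ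
    have hU := isOpen_smallParams (k := k) R
    have heq : EqOn (traceInt f) (polarInt (fun z => (2 * Real.pi * I)⁻¹ * f z) 1 R)
        (smallParams k R) := fun τ hτ => traceInt_eq hf hR hτ
    have h := opTtilde_polarInt hφ hR hσ hm hmk
    rw [opTtilde, opT] at h ⊢
    rw [pd_congr hU (pd_congr hU heq _) _ hσ, pd_congr hU (eulerOp_congr hU heq) _ hσ,
      pd_congr hU heq _ hσ, h]

theorem eval_P_axis (hk : 1 ≤ k) (s z : ℂ) :
    (P (s • basisVec k 1)).eval z = z ^ (k - 1) * (z - s) := by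
  rw [eval_P, map_smul, evalLin_basisVec le_rfl hk]
  have : z ^ k = z * z ^ (k - 1) := by rw [← pow_succ', Nat.sub_add_cancel hk]
  rw [this, smul_eq_mul]
  ring

/-- The factor `z^(k-1)` cancels against the one in `P_σ`, leaving Cauchy's formula for `h` at `s`.
-/
theorem traceInt_axis (hk : 1 ≤ k) {h : ℂ → ℂ} (hh : Differentiable ℂ h) (s : ℂ) :
    traceInt (fun z => z ^ (k - 1) * h z) (s • basisVec k 1) = h s := by
  have hd : Differentiable ℂ fun z => z ^ (k - 1) * h z := by fun_prop
  obtain ⟨R₀, hR₀, hσ₀⟩ := exists_mem_smallParams (s • basisVec k 1)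
  -- The first bound controls the roots by the norm estimate; the second puts `s` inside the circle.
  set R := max R₀ (‖s‖ + 1) with hRdef
  have hR : 1 ≤ R := hR₀.trans (le_max_left _ _)
  have hσ : s • basisVec k 1 ∈ smallParams k R :=
    mem_smallParams.2 (lt_of_lt_of_le hσ₀ (le_max_left _ _))
  have hs : s ∈ ball (0 : ℂ) R := by
    simp only [mem_ball, dist_zero_right]
    exact lt_of_lt_of_le (lt_add_one _) (le_max_right _ _)
  rw [traceInt_eq hd hR hσ, polarInt]
  have hc := (hh.differentiableOn (s := closedBall 0 R)).circleIntegral_sub_inv_smul hs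
  have : (∮ z in C(0, R), (2 * Real.pi * I)⁻¹ * (z ^ (k - 1) * h z) *
      ((P (s • basisVec k 1)).eval z)⁻¹ ^ 1) =
      ∮ z in C(0, R), (2 * Real.pi * I)⁻¹ • ((z - s)⁻¹ • h z) := by
    refine circleIntegral.integral_congr (zero_le_one.trans hR) fun z hz => ?_
    have hz' : ‖z‖ = R := by simpa using hz
    have hz0 : z ≠ 0 := by
      rintro rfl
      simp at hz'
      linarith
    simp only [eval_P_axis hk, smul_eq_mul, pow_one, mul_inv]
    have : z ^ (k - 1) ≠ 0 := pow_ne_zero _ hz0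
    field_simp
  rw [this, circleIntegral.integral_smul, hc, smul_eq_mul, smul_eq_mul,
    inv_mul_cancel_left₀ Complex.two_pi_I_ne_zero]

/-! ### Simple roots, the discriminant, and partial fractions. -/

theorem degree_P_tail_lt (σ : N k) :
    (∑ i : Fin k, Polynomial.C ((-1) ^ (i.val + 1) * σ i) *
      (Polynomial.X : ℂ[X]) ^ (k - (i.val + 1))).degree < k := by
  refine (degree_sum_le _ _).trans_lt ((Finset.sup_lt_iff (WithBot.bot_lt_coe k)).2 fun i _ => ?_)
  refine (degree_C_mul_X_pow_le _ _).trans_lt ?_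
  have := i.isLt
  exact WithBot.coe_lt_coe.2 (by simp only [Nat.cast_id]; omega)

theorem monic_P (σ : N k) : (P σ).Monic := monic_X_pow_add (degree_P_tail_lt σ)

theorem natDegree_P (σ : N k) : (P σ).natDegree = k := by
  refine natDegree_eq_of_degree_eq_some ?_
  rw [P, degree_add_eq_left_of_degree_lt, degree_X_pow]
  rw [degree_X_pow]
  exact degree_P_tail_lt σ

/-- For monic `P_σ` the discriminant is, up to sign, the resultant with the derivative, which
vanishes exactly when the two have a common factor. -/
theorem discr_P_ne_zero_iff (hk : 1 ≤ k) (σ : N k) : (P σ).discr ≠ 0 ↔ (P σ).Separable := by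
  have hdeg : 0 < (P σ).degree := natDegree_pos_iff_degree_pos.1 (by rw [natDegree_P]; omega)
  have h := resultant_deriv hdeg
  have hr := resultant_eq_zero_iff (f := P σ) (g := (P σ).derivative)
  rw [natDegree_derivative, h, (monic_P σ).leadingCoeff, mul_one, mul_eq_zero] at hr
  have hs : ((-1 : ℂ) ^ ((P σ).natDegree * ((P σ).natDegree - 1) / 2)) ≠ 0 :=
    pow_ne_zero _ (by norm_num)
  rw [separable_def, ← not_iff_not, not_not]
  simpa [hs, (monic_P σ).ne_zero] using hr

theorem P_add_smul_basisVec (hk : 1 ≤ k) (σ : N k) (c : ℂ) :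
    P (σ + c • basisVec k k) = P σ + Polynomial.C ((-1) ^ k * c) := by
  refine Polynomial.funext fun z => ?_
  rw [eval_add, eval_C, eval_P, eval_P, map_add, map_smul, evalLin_basisVec hk le_rfl]
  simp
  ring

/-- The polynomials `P_σ` with simple roots are dense: adding a constant other than the negative of
a critical value makes all roots simple. -/
theorem dense_discr_ne_zero (hk : 1 ≤ k) : Dense {σ : N k | (P σ).discr ≠ 0} := by
  intro σ
  have hd0 : (P σ).derivative ≠ 0 := by
    intro h
    have := derivative_eq_zero.1 h
    rw [natDegree_P] at this
    omega
  -- A shift by `c` in `σ_k` adds `(-1)^k c` to `P_σ` and keeps its derivative; `B` holds the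
  -- finitely many `c` that turn a critical point into a root.
  set B : Set ℂ := (fun w => -((-1) ^ k * (P σ).eval w)) '' {w | w ∈ (P σ).derivative.roots}
    with hB
  have hBfin : B.Finite := (Multiset.finite_toSet _).image _
  have hdense : Dense Bᶜ := hBfin.countable.dense_compl ℂ
  have hmap : MapsTo (fun c : ℂ => σ + c • basisVec k k) Bᶜ {σ : N k | (P σ).discr ≠ 0} := by
    intro c hc
    rw [Set.mem_ofPred_eq, discr_P_ne_zero_iff hk, separable_def,
      isCoprime_iff_aeval_ne_zero_of_isAlgClosed ℂ ℂ]
    intro a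
    by_contra! hcon
    obtain ⟨h1, h2⟩ := hcon
    rw [P_add_smul_basisVec hk] at h1 h2
    simp only [coe_aeval_eq_eval, eval_add, eval_C, derivative_add, derivative_C, add_zero]
      at h1 h2
    refine hc ⟨a, (mem_roots hd0).2 h2, ?_⟩
    have : ((-1 : ℂ) ^ k) * (-1) ^ k = 1 := by rw [← mul_pow]; simp
    simp only
    linear_combination (-1 : ℂ) ^ k * (-h1) + c * this
  have := map_mem_closure (f := fun c : ℂ => σ + c • basisVec k k) (by fun_prop) (hdense 0) hmap
  simpa using this

/-- For simple roots, `1 / P_σ` is the sum of `1 / (P_σ'(a) (z - a))` over the roots `a`; Cauchy's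
formula then evaluates each term. -/
theorem isTraceForm_traceInt (hk : 1 ≤ k) {f : ℂ → ℂ} (hf : Differentiable ℂ f) :
    IsTraceForm f (traceInt f : N k → ℂ) := by
  intro σ hσ
  have hsep := (discr_P_ne_zero_iff hk σ).1 hσ
  have hnd := nodup_roots hsep
  set S := (P σ).roots.toFinset with hS
  have hnodal : Lagrange.nodal S id = P σ := by
    have h1 := (IsAlgClosed.splits (P σ)).eq_prod_roots_of_monic (monic_P σ)
    rw [Lagrange.nodal, Finset.prod, hS, Multiset.toFinset_val, hnd.dedup]
    simpa using h1.symm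
  have hne : S.Nonempty := by
    rw [Finset.nonempty_iff_ne_empty]
    rintro h
    rw [h, Lagrange.nodal_empty] at hnodal
    have := natDegree_P σ
    rw [← hnodal, natDegree_one] at this
    omega
  obtain ⟨R, hR, hσR⟩ := exists_mem_smallParams σ
  have hR0 : 0 ≤ R := zero_le_one.trans hR
  have hball : ∀ a ∈ S, a ∈ ball (0 : ℂ) R := by
    intro a ha
    rw [mem_ball, dist_zero_right]
    by_contra! hcon
    exact eval_P_ne_zero_of_mem hR hσR hcon (isRoot_of_mem_roots (Multiset.mem_toFinset.1 ha))
  have hpf : ∀ z, (P σ).eval z ≠ 0 → ((P σ).eval z)⁻¹ =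
      ∑ a ∈ S, ((P σ).derivative.eval a)⁻¹ * (z - a)⁻¹ := by
    intro z hz
    have hza : ∀ a ∈ S, z ≠ id a := by
      rintro a ha rfl
      exact hz (isRoot_of_mem_roots (Multiset.mem_toFinset.1 ha))
    -- The partial fractions come from the Lagrange basis summing to `1`, divided by the nodal
    -- polynomial `P_σ`.
    have h1 := congrArg (Polynomial.eval z)
      (Lagrange.sum_basis (s := S) (v := id) (injOn_id _) hne)
    rw [eval_finsetSum, eval_one,
      Finset.sum_congr rfl fun a ha => Lagrange.eval_basis_not_at_node ha (hza a ha),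
      ← Finset.mul_sum, hnodal] at h1
    rw [inv_eq_of_mul_eq_one_right h1]
    refine Finset.sum_congr rfl fun a ha => ?_
    rw [Lagrange.nodalWeight_eq_eval_derivative_nodal ha, hnodal]
    rfl
  have htr : traceSum f σ = ∑ a ∈ S, f a / (P σ).derivative.eval a := by
    rw [traceSum, Finset.sum, hS, Multiset.toFinset_val, hnd.dedup]
  have hcont : ∀ a ∈ S, ContinuousOn (fun z => (z - a)⁻¹ * f z) (sphere 0 R) := by
    intro a ha
    refine ContinuousOn.mul ?_ hf.continuous.continuousOn
    refine ContinuousOn.inv₀ (by fun_prop) fun z hz h0 => ?_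
    have h1 := hball a ha
    rw [sub_eq_zero] at h0
    rw [← h0, mem_ball] at h1
    exact h1.ne hz
  have hint : (∮ z in C(0, R), (2 * Real.pi * I)⁻¹ * f z * ((P σ).eval z)⁻¹ ^ 1) =
      ∮ z in C(0, R), ∑ a ∈ S, ((2 * Real.pi * I)⁻¹ * ((P σ).derivative.eval a)⁻¹) •
        ((z - a)⁻¹ • f z) := by
    refine circleIntegral.integral_congr hR0 fun z hz => ?_
    have hz' : (P σ).eval z ≠ 0 :=
      eval_P_ne_zero_of_mem hR hσR (by rw [← dist_zero_right, mem_sphere.1 hz])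
    simp only [pow_one, hpf z hz', smul_eq_mul]
    rw [Finset.mul_sum]
    exact Finset.sum_congr rfl fun a _ => by ring
  rw [traceInt_eq hf hR hσR, polarInt, hint, htr, circleIntegral.integral_fun_sum]
  · refine Finset.sum_congr rfl fun a ha => ?_
    rw [circleIntegral.integral_smul,
      (hf.differentiableOn (s := closedBall 0 R)).circleIntegral_sub_inv_smul (hball a ha),
      smul_eq_mul, smul_eq_mul, mul_right_comm, inv_mul_cancel_left₀ Complex.two_pi_I_ne_zero]
    ring
  · intro a ha
    refine ContinuousOn.circleIntegrable hR0 ?_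
    exact (hcont a ha).fun_const_smul _

/-! ### Uniqueness of trace forms and division by powers of `z`. -/

theorem IsTraceForm.eq {f : ℂ → ℂ} {F G : N k → ℂ} (hk : 1 ≤ k) (hF : Continuous F)
    (hG : Continuous G) (h : IsTraceForm f F) (h' : IsTraceForm f G) : F = G :=
  Continuous.ext_on (dense_discr_ne_zero hk) hF hG fun σ hσ => (h σ hσ).trans (h' σ hσ).symm

theorem exists_eq_pow_mul_of_le_analyticOrderAt {g : ℂ → ℂ} (hg : Differentiable ℂ g) {n : ℕ}
    (h : (n : ℕ∞) ≤ analyticOrderAt g 0) :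
    ∃ u : ℂ → ℂ, Differentiable ℂ u ∧ g = fun z => z ^ n * u z := by
  obtain ⟨v, hv, hgv⟩ := (natCast_le_analyticOrderAt (hg.analyticAt 0)).1 h
  simp only [sub_zero, smul_eq_mul] at hgv
  -- The quotient with its removable singularity filled in by the local cofactor `v`.
  set u : ℂ → ℂ := fun z => if z = 0 then v 0 else g z / z ^ n with hu
  have huv : u =ᶠ[𝓝 0] v := by
    filter_upwards [hgv] with z hz
    by_cases hz0 : z = 0
    · simp [hu, hz0]
    · simp only [hu, hz0, if_false, hz]
      field_simp
  refine ⟨u, fun z => ?_, funext fun z => ?_⟩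
  · by_cases hz0 : z = 0
    · subst hz0
      exact hv.differentiableAt.congr_of_eventuallyEq huv
    · have : u =ᶠ[𝓝 z] fun w => g w / w ^ n := by
        filter_upwards [isOpen_ne.mem_nhds hz0] with w hw
        simp [hu, show w ≠ 0 from hw]
      refine DifferentiableAt.congr_of_eventuallyEq ?_ this
      exact (hg z).div (by fun_prop) (pow_ne_zero _ hz0)
  · by_cases hz0 : z = 0
    · subst hz0
      simpa [hu] using hgv.self_of_nhds
    · simp only [hu, hz0, if_false]
      field_simp

theorem le_analyticOrderAt_pow_mul {u : ℂ → ℂ} (hu : Differentiable ℂ u) (n : ℕ) :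
    (n : ℕ∞) ≤ analyticOrderAt (fun z => z ^ n * u z) 0 :=
  (natCast_le_analyticOrderAt (Differentiable.analyticAt (by fun_prop) 0)).2
    ⟨u, hu.analyticAt 0, by simp⟩

theorem SolvesS2.isTraceForm_axis (hk : 1 ≤ k) {G : N k → ℂ} (hG : Differentiable ℂ G)
    (hS : SolvesS2 G) : IsTraceForm (fun z => z ^ (k - 1) * G (z • basisVec k 1)) G := by
  have hu : Differentiable ℂ fun z : ℂ => G (z • basisVec k 1) := hG.comp (by fun_prop)
  have hg : Differentiable ℂ fun z : ℂ => z ^ (k - 1) * G (z • basisVec k 1) := by fun_prop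
  have heq : G = traceInt fun z => z ^ (k - 1) * G (z • basisVec k 1) :=
    hS.eq_of_axis hG (differentiable_traceInt hg) (solvesS2_traceInt hg) fun s =>
      (traceInt_axis hk hu s).symm
  intro σ hσ
  exact (congrFun heq σ).trans (isTraceForm_traceInt hk hg σ hσ)

theorem IsTraceForm.eq_traceInt (hk : 1 ≤ k) {f : ℂ → ℂ} (hf : Differentiable ℂ f) {G : N k → ℂ}
    (hG : Differentiable ℂ G) (h : IsTraceForm f G) : G = traceInt f :=
  h.eq hk hG.continuous (differentiable_traceInt hf).continuous (isTraceForm_traceInt hk hf)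

end TraceForms

theorem theorem3 (k : ℕ) (hk : 1 ≤ k) :
    (∀ G : TraceForms.N k → ℂ, Differentiable ℂ G → TraceForms.SolvesS2 G →
      ∃! g : ℂ → ℂ, Differentiable ℂ g ∧ ((k - 1 : ℕ) : ℕ∞) ≤ analyticOrderAt g 0 ∧
        TraceForms.IsTraceForm g G) ∧
    (∀ f : ℂ → ℂ, Differentiable ℂ f →
      ∃! G : TraceForms.N k → ℂ, Differentiable ℂ G ∧ TraceForms.IsTraceForm f G) ∧
    (∀ G : TraceForms.N k → ℂ, Differentiable ℂ G →
      (TraceForms.SolvesS2 G ↔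
        ∃ f : ℂ → ℂ, Differentiable ℂ f ∧ TraceForms.IsTraceForm f G)) := by
  have hu : ∀ G : TraceForms.N k → ℂ, Differentiable ℂ G →
      Differentiable ℂ fun z : ℂ => G (z • TraceForms.basisVec k 1) :=
    fun G hG => hG.comp (by fun_prop)
  have hg : ∀ G : TraceForms.N k → ℂ, Differentiable ℂ G →
      Differentiable ℂ fun z : ℂ => z ^ (k - 1) * G (z • TraceForms.basisVec k 1) :=
    fun G hG => (differentiable_id.pow _).mul (hu G hG)
  refine ⟨fun G hG hS => ?_, fun f hf => ?_, fun G hG => ⟨fun hS => ?_, ?_⟩⟩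
  · refine ⟨_, ⟨hg G hG, TraceForms.le_analyticOrderAt_pow_mul (hu G hG) _,
      hS.isTraceForm_axis hk hG⟩, ?_⟩
    rintro g ⟨hgd, hord, hgG⟩
    -- With `g = z^(k-1) u`, the restriction of `G` to the axis is `u`, so `G` determines `g`.
    obtain ⟨u, hud, rfl⟩ := TraceForms.exists_eq_pow_mul_of_le_analyticOrderAt hgd hord
    funext z
    rw [hgG.eq_traceInt hk hgd hG, TraceForms.traceInt_axis hk hud]
  · exact ⟨TraceForms.traceInt f, ⟨TraceForms.differentiable_traceInt hf,
      TraceForms.isTraceForm_traceInt hk hf⟩, fun G hG => hG.2.eq_traceInt hk hf hG.1⟩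
  · exact ⟨_, hg G hG, hS.isTraceForm_axis hk hG⟩
  · rintro ⟨f, hf, h⟩
    rw [h.eq_traceInt hk hf hG]
    exact TraceForms.solvesS2_traceInt hf
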